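/- For every accuracy parameter $M>0$ there are constants $\alpha(M)>0$ and $C(M)>0$, depending only on $M$, such that the following holds. Let $n\ge 2$, put $N=n^2$, and let $0<\tau<1$. Let $f=f(t_1,t_2)$, $1\le t_1,t_2\le n$, be a complex-valued discrete signal on the $n\times n$ grid (coordinates read modulo $n$) which is supported on a set $T$ of grid points with $$|T|\le \alpha(M)\cdot(\log N)^{-1}\cdot \tau N .$$ Let $(I_k)$, indexed by the $N$ frequencies $k=(k_1,k_2)\in(\mathbb Z/n\mathbb Z)^2$, be independent Bernoulli random variables with $\mathbf P(I_k=1)=\tau$ and $\mathbf P(I_k=0)=1-\tau$, and let $\Omega=\{k: I_k=1\}$ be the resulting random set of frequencies. Write $\hat g(k)=\sum_{t_1,t_2} g(t_1,t_2)\,e^{-2\pi i(k_1t_1+k_2t_2)/n}$ for the two-dimensional discrete Fourier transform, and consider the problem $$(P_1)\qquad \min_{g}\ \|g\|_{\ell_1}:=\sum_{t_1,t_2}|g(t_1,t_2)|\quad\text{subject to}\quad \hat g(k)=\hat f(k)\ \text{ for all } k\in\Omega,$$ where $g$ ranges over all complex-valued signals on the grid. Then with probability at least $1-C(M)\,N^{-M}$,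 the minimizer to $(P_1)$ is unique and is equal to $f$. -/

import Mathlib

open MeasureTheory ProbabilityTheory

noncomputable section

namespace ExactRecovery

/-- The `n × n` grid; it indexes both the positions `(t₁, t₂)` and the frequencies `(k₁, k₂)`,
coordinates being read modulo `n`. It has `n ^ 2` points. -/
abbrev Grid (n : ℕ) : Type := ZMod n × ZMod n

/-- The two-dimensional discrete Fourier transform
`f̂(k₁, k₂) = ∑_{t₁, t₂} f(t₁, t₂) exp(-2πi (k₁ t₁ + k₂ t₂) / n)`. -/
def dft2 {n : ℕ} [NeZero n] (f : Grid n → ℂ) (k : Grid n) : ℂ :=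
  ∑ t : Grid n, f t * ZMod.stdAddChar (-(k.1 * t.1 + k.2 * t.2))

/-- The transform `dft2` written with complex exponentials. -/
theorem dft2_eq_sum_exp {n : ℕ} [NeZero n] (f : Grid n → ℂ) (k : Grid n) :
    dft2 f k = ∑ t : Grid n, f t *
      Complex.exp (-(2 * Real.pi * Complex.I *
        (k.1.val * t.1.val + k.2.val * t.2.val) / n)) := by
  unfold dft2
  refine Finset.sum_congr rfl fun t _ => ?_
  have h : (-(k.1 * t.1 + k.2 * t.2) : ZMod n) =
      ((-((k.1.val : ℤ) * t.1.val + k.2.val * t.2.val) : ℤ) : ZMod n) := by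
    push_cast
    simp only [ZMod.natCast_val, ZMod.cast_id', id_eq]
  rw [h, ZMod.stdAddChar_coe]
  congr 2
  push_cast
  ring

/-- The `ℓ₁` norm `∑_t |g(t)|`. -/
def l1Norm {n : ℕ} [NeZero n] (g : Grid n → ℂ) : ℝ := ∑ t : Grid n, ‖g t‖

/-- The feasible set of `(P₁)`: the signals whose Fourier coefficients agree with those of `f`
at every frequency in `W`. -/
def feasibleSet {n : ℕ} [NeZero n] (f : Grid n → ℂ) (W : Set (Grid n)) : Set (Grid n → ℂ) :=
  {g | ∀ k ∈ W, dft2 g k = dft2 f k}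

/-- The set of minimizers of the problem `(P₁)`: minimize `‖g‖_{ℓ₁}` over all signals `g` with
`ĝ = f̂` on `W`. -/
def minimizers {n : ℕ} [NeZero n] (f : Grid n → ℂ) (W : Set (Grid n)) : Set (Grid n → ℂ) :=
  {g | g ∈ feasibleSet f W ∧ IsMinOn l1Norm (feasibleSet f W) g}

/-- `(I_k)_k` is a family of independent Bernoulli random variables with parameter `τ`:
each `I_k` is `1` with probability `τ` and `0` with probability `1 - τ`. -/
structure IsBernoulliFamily {ι S : Type*} [MeasurableSpace S] (P : Measure S) (τ : ℝ)
    (I : ι → S → ℝ) : Prop where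
  measurable : ∀ k, Measurable (I k)
  indep : iIndepFun I P
  prob_one : ∀ k, P.real {s | I k s = 1} = τ
  prob_zero : ∀ k, P.real {s | I k s = 0} = 1 - τ

/-- The random set of frequencies `{k : I_k = 1}`. -/
def frequencySet {ι S : Type*} (I : ι → S → ℝ) (s : S) : Set ι := {k | I k s = 1}

end ExactRecovery

end

namespace ExactRecovery

open Finset

/-! Write `N = n ^ 2`, and let `Y d` be the sum over all frequencies of the centred selector times
the corresponding character at `d`. Sampling the Fourier transform of a signal on `T` and
transforming back, divided by `τ N`, is the inclusion plus convolution by `Y / (τ N)`. If the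
iterates of this random kernel on `T`, started at `z`, are at most `4 ^ (-m)` everywhere for `1 ≤ m
≤ m₀`, the truncated alternating Neumann series gives a polynomial with sampled frequencies which
agrees with `z` on `T` up to `4 ^ (-m₀)` and is at most `1/3` off `T`. A perturbation `h` with no
sampled coefficients is orthogonal to it (`norm_sum_mul_conj_le`).

With `z` the sign of `f`, this bounds the loss of norm on `T`. The error on `T` is absorbed by the
same certificate for each unit vector of `T`: these control the mass of `h` on `T` by its mass off
`T`, so no restricted operator has to be inverted (`sum_norm_lt_sum_norm_add`).

The decay comes from `2q`-th moments, expanded over chains of points of `T`. The moment-cumulant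
recursion merges a factor with a block of others, and orthogonality of characters forces the
differences in the block to sum to zero. Singletons vanish by centring. Starting from a factor
furthest along its chain, the condition fixes one vertex and saves a factor `#T`
(`sum_norm_prodExpect_prod_noise_le`). Markov's inequality with `q m` of order `log N` and a union
bound over targets, steps and points finish the proof. -/

/-! ### Product weights and resampling. -/

/-- The weight of a configuration under the product of the weights `p`. -/
def prodWeight {R ι α : Type*} [CommSemiring R] [Fintype ι] (p : α → R) (ω : ι → α) : R :=
  ∏ k, p (ω k)

theorem prodWeight_update_mul {R ι α : Type*} [CommSemiring R] [Fintype ι] [DecidableEq ι]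
    (p : α → R) (ω : ι → α) (k : ι) (v : α) :
    prodWeight p (Function.update ω k v) * p (ω k) = prodWeight p ω * p v := by
  unfold prodWeight
  rw [← mul_prod_erase univ (fun i => p (Function.update ω k v i)) (mem_univ k),
    ← mul_prod_erase univ (fun i => p (ω i)) (mem_univ k)]
  have : ∏ i ∈ univ.erase k, p (Function.update ω k v i) = ∏ i ∈ univ.erase k, p (ω i) :=
    prod_congr rfl fun i hi => by rw [Function.update_of_ne (ne_of_mem_erase hi)]
  rw [this, Function.update_self]
  ring

/-- Resampling one coordinate does not change a weighted sum. -/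
theorem sum_prodWeight_resample {R ι α : Type*} [CommSemiring R] [Fintype ι] [DecidableEq ι]
    [Fintype α] (p : α → R) (k : ι) (F : (ι → α) → R) :
    ∑ ω, prodWeight p ω * ∑ v, p v * F (Function.update ω k v) =
      (∑ v, p v) * ∑ ω, prodWeight p ω * F ω := by
  have h : ∑ x : (ι → α) × α, prodWeight p x.1 * p x.2 * F (Function.update x.1 k x.2) =
      ∑ x : (ι → α) × α, p x.2 * (prodWeight p x.1 * F x.1) := by
    -- Swapping the fresh value with the old one is an involution.
    refine sum_bij' (fun x _ => (Function.update x.1 k x.2, x.1 k))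
      (fun x _ => (Function.update x.1 k x.2, x.1 k)) ?_ ?_ ?_ ?_ ?_
    · simp
    · simp
    · simp
    · simp
    · rintro ⟨ω, v⟩ -
      simp only
      rw [← prodWeight_update_mul]
      ring
  rw [Fintype.sum_prod_type, Fintype.sum_prod_type_right] at h
  simp only [mul_sum, sum_mul, ← mul_assoc] at h ⊢
  rw [h, sum_comm]

theorem sum_sum_update {ι α : Type*} [Fintype ι] [DecidableEq ι] [Fintype α] (k : ι)
    (F : (ι → α) → ℝ) :
    ∑ ω, ∑ v, F (Function.update ω k v) = Fintype.card α * ∑ ω, F ω := by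
  have := sum_prodWeight_resample (fun _ : α => (1 : ℝ)) k F
  simpa [prodWeight] using this

theorem sum_prodWeight {R ι α : Type*} [CommSemiring R] [Fintype ι] [DecidableEq ι]
    [Fintype α] (p : α → R) (hp : ∑ v, p v = 1) : ∑ ω : ι → α, prodWeight p ω = 1 := by
  unfold prodWeight
  rw [← Fintype.piFinset_univ, ← prod_univ_sum]
  simp [hp]

/-! ### Cumulants of one variable. -/

/-- The cumulant of order `n + 1` of a distribution with moments `μ`, by the recursion
`μ (n + 1) = ∑ r ≤ n, n.choose r * κ (r + 1) * μ (n - r)`. -/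
def cumulantSucc (μ : ℕ → ℂ) (n : ℕ) : ℂ :=
  μ (n + 1) - ∑ r : Fin n, (n.choose r : ℂ) * cumulantSucc μ r * μ (n - r)
termination_by n
decreasing_by exact r.2

theorem sum_choose_mul_cumulantSucc (μ : ℕ → ℂ) (h0 : μ 0 = 1) (n : ℕ) :
    ∑ r ∈ range (n + 1), (n.choose r : ℂ) * (cumulantSucc μ r * μ (n - r)) = μ (n + 1) := by
  rw [sum_range_succ, cumulantSucc.eq_def μ n, sum_range]
  simp [h0, mul_assoc]

/-- All moments being at most `τ`, the bound stays linear in `τ`: a merged block costs one factor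
`τ`, whatever its size. The factorial is later absorbed by the count of blocks. -/
theorem norm_cumulantSucc_le (μ : ℕ → ℂ) (τ : ℝ) (hτ0 : 0 ≤ τ) (hτ1 : τ ≤ 1)
    (hμ : ∀ n, ‖μ (n + 1)‖ ≤ τ) (n : ℕ) :
    ‖cumulantSucc μ n‖ ≤ τ * 2 ^ (n + 1) * n.factorial := by
  induction n using Nat.strong_induction_on with
  | _ n ih =>
  rw [cumulantSucc.eq_def]
  have hterm : ∀ r : Fin n, ‖(n.choose r : ℂ) * cumulantSucc μ r * μ (n - r)‖ ≤
      τ * n.factorial * 2 ^ ((r : ℕ) + 1) := by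
    intro r
    have hr := ih r r.2
    have hm : ‖μ (n - r)‖ ≤ 1 := by
      obtain ⟨j, hj⟩ : ∃ j, n - (r : ℕ) = j + 1 := ⟨n - r - 1, by have := r.2; omega⟩
      rw [hj]
      exact (hμ j).trans hτ1
    have hc : (n.choose r : ℝ) * (r : ℕ).factorial ≤ n.factorial := by
      have h := Nat.choose_mul_factorial_mul_factorial r.2.le
      have : n.choose r * (r : ℕ).factorial ≤ n.factorial := by
        rw [← h]
        exact Nat.le_mul_of_pos_right _ (Nat.factorial_pos _)
      exact_mod_cast this
    rw [norm_mul, norm_mul, Complex.norm_natCast]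
    calc (n.choose r : ℝ) * ‖cumulantSucc μ r‖ * ‖μ (n - r)‖
        ≤ (n.choose r : ℝ) * (τ * 2 ^ ((r : ℕ) + 1) * (r : ℕ).factorial) * 1 := by gcongr
      _ = τ * 2 ^ ((r : ℕ) + 1) * ((n.choose r : ℝ) * (r : ℕ).factorial) := by ring
      _ ≤ τ * 2 ^ ((r : ℕ) + 1) * n.factorial := by gcongr
      _ = _ := by ring
  have hgeom : ∑ r : Fin n, (2 : ℝ) ^ ((r : ℕ) + 1) = 2 ^ (n + 1) - 2 := by
    rw [← sum_range (fun r => (2 : ℝ) ^ (r + 1))]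
    simp only [pow_succ, ← sum_mul]
    rw [geom_sum_eq (by norm_num)]
    ring
  have h1 : (1 : ℝ) ≤ n.factorial := by exact_mod_cast Nat.factorial_pos n
  calc _ ≤ ‖μ (n + 1)‖ + ‖∑ r : Fin n, (n.choose r : ℂ) * cumulantSucc μ r * μ (n - r)‖ :=
        norm_sub_le _ _
    _ ≤ τ + ∑ r : Fin n, τ * n.factorial * 2 ^ ((r : ℕ) + 1) :=
        add_le_add (hμ n) ((norm_sum_le _ _).trans (sum_le_sum fun r _ => hterm r))
    _ = τ + τ * n.factorial * (2 ^ (n + 1) - 2) := by rw [← mul_sum, hgeom]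
    _ ≤ _ := by nlinarith [mul_le_mul_of_nonneg_left h1 hτ0]

/-- Ordered pairs of disjoint subsets are reindexed by their union and its first part. -/
theorem sum_powerset_sdiff {κ M : Type*} [DecidableEq κ] [AddCommMonoid M] (J : Finset κ)
    (F : Finset κ → Finset κ → M) :
    ∑ B ∈ J.powerset, ∑ C ∈ (J \ B).powerset, F B C =
      ∑ D ∈ J.powerset, ∑ B ∈ D.powerset, F B (D \ B) := by
  rw [sum_sigma', sum_sigma']
  refine sum_bij' (fun x _ => ⟨x.1 ∪ x.2, x.1⟩) (fun x _ => ⟨x.2, x.1 \ x.2⟩) ?_ ?_ ?_ ?_ ?_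
  · rintro ⟨B, C⟩ h
    simp only [mem_sigma, mem_powerset, subset_sdiff] at h ⊢
    exact ⟨union_subset h.1 h.2.1, subset_union_left⟩
  · rintro ⟨D, B⟩ h
    simp only [mem_sigma, mem_powerset] at h ⊢
    exact ⟨h.2.trans h.1, sdiff_subset_sdiff h.1 (Subset.refl _)⟩
  · rintro ⟨B, C⟩ h
    simp only [mem_sigma, mem_powerset, subset_sdiff] at h ⊢
    rw [union_sdiff_cancel_left h.2.2.symm]
  · rintro ⟨D, B⟩ h
    simp only [mem_sigma, mem_powerset] at h ⊢
    rw [union_sdiff_of_subset h.2]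
  · rintro ⟨B, C⟩ h
    simp only [mem_sigma, mem_powerset, subset_sdiff] at h ⊢
    rw [union_sdiff_cancel_left h.2.2.symm]

theorem sum_mul_pow_mul_prod_add {κ α : Type*} [DecidableEq κ] [Fintype α] (p x : α → ℂ) (r : ℕ)
    (J : Finset κ) (a b : κ → ℂ) :
    ∑ v, p v * (x v ^ r * ∏ j ∈ J, (b j * x v + a j)) =
      ∑ C ∈ J.powerset, (∏ j ∈ C, b j) * (∏ j ∈ J \ C, a j) * ∑ v, p v * x v ^ (#C + r) := by
  simp only [prod_add, mul_sum]
  rw [sum_comm]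
  refine sum_congr rfl fun C _ => sum_congr rfl fun v _ => ?_
  rw [prod_mul_distrib, prod_const, pow_add]
  ring

/-- The moment-cumulant recursion for a product of affine functions of one variable. -/
theorem sum_mul_prod_add_eq_cumulantSucc {κ α : Type*} [DecidableEq κ] [Fintype α] (p x : α → ℂ)
    (hp : ∑ v, p v = 1) (J : Finset κ) (a b : κ → ℂ) :
    ∑ v, p v * (x v * ∏ j ∈ J, (b j * x v + a j)) =
      ∑ B ∈ J.powerset, cumulantSucc (fun r => ∑ v, p v * x v ^ r) #B * (∏ j ∈ B, b j) *
        ∑ v, p v * ∏ j ∈ J \ B, (b j * x v + a j) := by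
  set μ : ℕ → ℂ := fun r => ∑ v, p v * x v ^ r with hμ
  have hL := sum_mul_pow_mul_prod_add p x 1 J a b
  have hR := fun B => sum_mul_pow_mul_prod_add p x 0 (J \ B) a b
  simp only [pow_one, pow_zero, one_mul, add_zero] at hL hR
  simp only [hL, hR, mul_sum (s := powerset _)]
  rw [sum_powerset_sdiff]
  refine sum_congr rfl fun D hD => ?_
  have h0 : μ 0 = 1 := by simp [hμ, hp]
  change _ * μ (#D + 1) = _
  have hcard := sum_powerset_apply_card (fun r => cumulantSucc μ r * μ (#D - r)) (x := D)
  simp only [nsmul_eq_mul] at hcard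
  rw [← sum_choose_mul_cumulantSucc μ h0, ← hcard, mul_sum]
  refine sum_congr rfl fun B hB => ?_
  rw [mem_powerset] at hB hD
  rw [card_sdiff_of_subset hB, ← prod_sdiff hB]
  have : (J \ B) \ (D \ B) = J \ D := by
    ext j
    simp only [mem_sdiff]
    grind
  rw [this]
  ring

/-! ### Mixed moments of random exponential sums. -/

/-- The expectation of `F` under the product of the weights `p`. -/
def prodExpect {ι α : Type*} [Fintype ι] [DecidableEq ι] [Fintype α] (p : α → ℂ)
    (F : (ι → α) → ℂ) : ℂ :=
  ∑ ω, prodWeight p ω * F ω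

/-- The random exponential sum `∑ k, x (ω k) * e k d`. -/
def noise {ι G α : Type*} [Fintype ι] [AddCommGroup G] (e : ι → AddChar G ℂ) (x : α → ℂ)
    (ω : ι → α) (d : G) : ℂ :=
  ∑ k, x (ω k) * e k d

theorem noise_update {ι G α : Type*} [Fintype ι] [DecidableEq ι] [AddCommGroup G]
    (e : ι → AddChar G ℂ) (x : α → ℂ) (ω : ι → α) (k : ι) (v : α) (d : G) :
    noise e x (Function.update ω k v) d =
      e k d * x v + ∑ i ∈ univ.erase k, x (ω i) * e i d := by
  unfold noise
  rw [← add_sum_erase univ _ (mem_univ k), Function.update_self, mul_comm (x v)]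
  congr 1
  exact sum_congr rfl fun i hi => by rw [Function.update_of_ne (ne_of_mem_erase hi)]

theorem prodExpect_resample {ι α : Type*} [Fintype ι] [DecidableEq ι] [Fintype α] (p : α → ℂ)
    (hp : ∑ v, p v = 1) (k : ι) (F : (ι → α) → ℂ) :
    prodExpect p F = prodExpect p fun ω => ∑ v, p v * F (Function.update ω k v) := by
  unfold prodExpect
  rw [sum_prodWeight_resample, hp, one_mul]

theorem prodExpect_sum {ι α β : Type*} [Fintype ι] [DecidableEq ι] [Fintype α] (p : α → ℂ)
    (s : Finset β) (F : β → (ι → α) → ℂ) :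
    prodExpect p (fun ω => ∑ b ∈ s, F b ω) = ∑ b ∈ s, prodExpect p (F b) := by
  unfold prodExpect
  simp only [mul_sum]
  exact sum_comm

theorem prodExpect_const_mul {ι α : Type*} [Fintype ι] [DecidableEq ι] [Fintype α] (p : α → ℂ)
    (c : ℂ) (F : (ι → α) → ℂ) :
    prodExpect p (fun ω => c * F ω) = c * prodExpect p F := by
  unfold prodExpect
  rw [mul_sum]
  exact sum_congr rfl fun ω _ => by ring

theorem map_sum_eq_prod {G κ : Type*} [AddCommGroup G] (ψ : AddChar G ℂ) (B : Finset κ)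
    (D : κ → G) : ψ (∑ j ∈ B, D j) = ∏ j ∈ B, ψ (D j) := by
  classical
  induction B using Finset.induction_on with
  | empty => simp
  | insert j B hj ih => rw [sum_insert hj, prod_insert hj, AddChar.map_add_eq_mul, ih]

/-- The moment-cumulant recursion for products of exponential sums with independent
coefficients. -/
theorem prodExpect_noise_mul_prod {ι G α κ : Type*} [Fintype ι] [DecidableEq ι] [Fintype α]
    [DecidableEq κ] [AddCommGroup G] (e : ι → AddChar G ℂ) (p x : α → ℂ) (hp : ∑ v, p v = 1)
    (d : G) (J : Finset κ) (D : κ → G) :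
    prodExpect p (fun ω => noise e x ω d * ∏ j ∈ J, noise e x ω (D j)) =
      ∑ B ∈ J.powerset, cumulantSucc (fun r => ∑ v, p v * x v ^ r) #B *
        (∑ k, e k (d + ∑ j ∈ B, D j)) *
          prodExpect p (fun ω => ∏ j ∈ J \ B, noise e x ω (D j)) := by
  have hk : ∀ k, prodExpect p (fun ω => x (ω k) * ∏ j ∈ J, noise e x ω (D j)) =
      ∑ B ∈ J.powerset, cumulantSucc (fun r => ∑ v, p v * x v ^ r) #B * (∏ j ∈ B, e k (D j)) *
          prodExpect p (fun ω => ∏ j ∈ J \ B, noise e x ω (D j)) := by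
    intro k
    rw [prodExpect_resample p hp k]
    simp only [noise_update, Function.update_self]
    simp_rw [sum_mul_prod_add_eq_cumulantSucc p x hp J]
    rw [prodExpect_sum]
    refine sum_congr rfl fun B _ => ?_
    rw [prodExpect_const_mul, prodExpect_resample p hp k (fun ω => ∏ j ∈ J \ B, _)]
    simp only [noise_update]
  have hexp : (fun ω => noise e x ω d * ∏ j ∈ J, noise e x ω (D j)) =
      fun ω => ∑ k, e k d * (x (ω k) * ∏ j ∈ J, noise e x ω (D j)) := by
    funext ω
    rw [noise, sum_mul]
    exact sum_congr rfl fun k _ => by ring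
  rw [hexp, prodExpect_sum]
  simp_rw [prodExpect_const_mul, hk, mul_sum, sum_mul]
  rw [sum_comm]
  refine sum_congr rfl fun B _ => sum_congr rfl fun k _ => ?_
  rw [AddChar.map_add_eq_mul, map_sum_eq_prod]
  ring

/-! ### Summing mixed moments over triangular families. -/

/-- A family of functions of `t` such that each `D j` is an injective function of `t j`, and does
not depend on `t i` when the rank of `i` is at least that of `j`. -/
structure IsTriangular {κ A G : Type*} [DecidableEq κ] (rank : κ → ℕ) (D : κ → (κ → A) → G) :
    Prop where
  update_of_ne : ∀ i j, j ≠ i → rank j ≤ rank i → ∀ t v, D j (Function.update t i v) = D j t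
  injective : ∀ j t, Function.Injective fun v => D j (Function.update t j v)

/-- With the other coordinates fixed, only `D i` varies with `t i`, and injectively; hence at most
one value of `t i` meets the linear condition. -/
theorem IsTriangular.card_mul_sum_le {κ A G : Type*} [Fintype κ] [DecidableEq κ] [Fintype A]
    [AddCommGroup G] [DecidableEq G] {rank : κ → ℕ} {D : κ → (κ → A) → G}
    (hD : IsTriangular rank D) (i : κ) (B : Finset κ) (hB : ∀ j ∈ B, j ≠ i ∧ rank j ≤ rank i)
    (g : (κ → A) → ℝ) (hg0 : ∀ t, 0 ≤ g t) (hg : ∀ t v, g (Function.update t i v) = g t) :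
    Fintype.card A * ∑ t, (if D i t + ∑ j ∈ B, D j t = 0 then g t else 0) ≤ ∑ t, g t := by
  rw [← sum_sum_update i]
  refine sum_le_sum fun t _ => ?_
  have hs : ∀ v, ∑ j ∈ B, D j (Function.update t i v) = ∑ j ∈ B, D j t := fun v =>
    sum_congr rfl fun j hj => hD.update_of_ne i j (hB j hj).1 (hB j hj).2 t v
  simp only [hs, hg]
  rw [← sum_filter, sum_const, nsmul_eq_mul]
  have hc : #{v | D i (Function.update t i v) + ∑ j ∈ B, D j t = 0} ≤ 1 := by
    rw [card_le_one]
    intro v hv w hw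
    simp only [mem_filter, mem_univ, true_and] at hv hw
    exact hD.injective i t (add_right_cancel (hv.trans hw.symm))
  calc _ ≤ (1 : ℝ) * g t := by
        gcongr
        · exact hg0 t
        · exact_mod_cast hc
    _ = g t := one_mul _

/-- The two conditions on `a` make the summand with index `r` at most `a ^ (n + 1) / 2 ^ (r + 1)`.
-/
theorem sum_geometric_bound (lam K a : ℝ) (hK : 0 < K) (ha : 4 * K ≤ a)
    (ha2 : 8 * lam * K ≤ a ^ 2) (n : ℕ) :
    ∑ r ∈ range n, lam * 2 ^ (r + 2) * K ^ (r + 1) * a ^ (n - (r + 1)) ≤ a ^ (n + 1) := by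
  have ha0 : 0 < a := by linarith
  have hstep : ∀ r ∈ range n, lam * 2 ^ (r + 2) * K ^ (r + 1) * a ^ (n - (r + 1)) ≤
      a ^ (n + 1) * (1 / 2) ^ (r + 1) := by
    intro r hr
    rw [mem_range] at hr
    obtain ⟨j, rfl⟩ : ∃ j, n = j + (r + 1) := ⟨n - (r + 1), by omega⟩
    rw [Nat.add_sub_cancel]
    have h2 : (2 * (2 * K)) ^ r ≤ a ^ r := by
      gcongr
      linarith
    have h3 : lam * 2 ^ (r + 2) * K ^ (r + 1) = (8 * lam * K) * (2 * (2 * K)) ^ r *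
        (1 / 2) ^ (r + 1) := by
      rw [mul_pow 2 (2 * K), mul_pow 2 K, one_div, inv_pow]
      field_simp
      ring
    rw [h3]
    calc (8 * lam * K) * (2 * (2 * K)) ^ r * (1 / 2) ^ (r + 1) * a ^ j
        ≤ a ^ 2 * a ^ r * (1 / 2) ^ (r + 1) * a ^ j := by gcongr
      _ = _ := by ring
  calc _ ≤ ∑ r ∈ range n, a ^ (n + 1) * (1 / 2) ^ (r + 1) := sum_le_sum hstep
    _ = a ^ (n + 1) * (1 - (1 / 2) ^ n) := by
        rw [← mul_sum]
        simp only [pow_succ (1 / 2 : ℝ), ← sum_mul]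
        rw [geom_sum_eq (by norm_num)]
        ring
    _ ≤ a ^ (n + 1) * 1 := by
        gcongr
        linarith [show (0 : ℝ) ≤ (1 / 2) ^ n by positivity]
    _ = _ := mul_one _

/-- The sum over `t` of the mixed moments of exponential sums along a triangular family. -/
theorem sum_norm_prodExpect_prod_noise_le {ι G α κ A : Type*} [Fintype ι] [DecidableEq ι]
    [Fintype α] [Fintype κ] [DecidableEq κ] [Fintype A] [Nonempty A] [AddCommGroup G]
    [DecidableEq G] (e : ι → AddChar G ℂ) (N : ℝ) (hN : 0 ≤ N)
    (he : ∀ d, ∑ k, e k d = if d = 0 then (N : ℂ) else 0)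
    (p x : α → ℂ) (hp : ∑ v, p v = 1) (hx : ∑ v, p v * x v = 0) (τ : ℝ) (hτ0 : 0 ≤ τ)
    (hτ1 : τ ≤ 1) (hμ : ∀ n, ‖∑ v, p v * x v ^ (n + 1)‖ ≤ τ)
    {rank : κ → ℕ} {D : κ → (κ → A) → G} (hD : IsTriangular rank D) (a : ℝ)
    (hK : 0 < Fintype.card κ) (ha : 4 * (Fintype.card κ : ℝ) ≤ a)
    (ha2 : 8 * (τ * N / Fintype.card A) * Fintype.card κ ≤ a ^ 2) (J : Finset κ) :
    ∑ t, ‖prodExpect p fun ω => ∏ j ∈ J, noise e x ω (D j t)‖ ≤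
      Fintype.card A ^ Fintype.card κ * a ^ #J := by
  set μ : ℕ → ℂ := fun r => ∑ v, p v * x v ^ r with hμdef
  set K : ℝ := (Fintype.card κ : ℝ) with hKdef
  set s : ℝ := (Fintype.card A : ℝ) with hsdef
  have hK' : 0 < K := Nat.cast_pos.2 hK
  have hs : 0 < s := Nat.cast_pos.2 Fintype.card_pos
  have ha0 : 0 < a := by linarith
  induction hn : #J using Nat.strong_induction_on generalizing J with
  | _ n ih =>
  rcases J.eq_empty_or_nonempty with rfl | hJ
  · subst hn
    have : prodExpect (ι := ι) p (fun _ => 1) = 1 := by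
      simp [prodExpect, sum_prodWeight p hp]
    simp [this, hsdef]
  -- Maximal rank ensures that no other factor, whether merged with `i` or left over, depends on `t
  -- i`.
  obtain ⟨i, hiJ, hi⟩ := exists_max_image J rank hJ
  set L := J.erase i with hL
  have hcard : #L + 1 = n := by rw [← hn, card_erase_add_one hiJ]
  have hLi : ∀ j ∈ L, j ≠ i ∧ rank j ≤ rank i := fun j hj =>
    ⟨ne_of_mem_erase hj, hi j (mem_of_mem_erase hj)⟩
  have hrec : ∀ t, ‖prodExpect p fun ω => ∏ j ∈ J, noise e x ω (D j t)‖ ≤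
      ∑ B ∈ L.powerset, ‖cumulantSucc μ #B‖ * N *
        (if D i t + ∑ j ∈ B, D j t = 0 then
          ‖prodExpect p fun ω => ∏ j ∈ L \ B, noise e x ω (D j t)‖ else 0) := by
    intro t
    have := prodExpect_noise_mul_prod e p x hp (D i t) L (fun j => D j t)
    have hprod : ∀ ω, ∏ j ∈ J, noise e x ω (D j t) =
        noise e x ω (D i t) * ∏ j ∈ L, noise e x ω (D j t) := fun ω =>
      (mul_prod_erase J (fun j => noise e x ω (D j t)) hiJ).symm
    simp only [hprod]
    rw [this]
    refine (norm_sum_le _ _).trans (sum_le_sum fun B _ => ?_)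
    rw [he]
    split_ifs
    · rw [norm_mul, norm_mul, Complex.norm_real, Real.norm_of_nonneg hN]
    · simp
  have hmain : ∀ B ∈ L.powerset, ∑ t, ‖cumulantSucc μ #B‖ * N *
        (if D i t + ∑ j ∈ B, D j t = 0 then
          ‖prodExpect p fun ω => ∏ j ∈ L \ B, noise e x ω (D j t)‖ else 0) ≤
      ‖cumulantSucc μ #B‖ * N * (s ^ Fintype.card κ * a ^ (#L - #B) / s) := by
    intro B hB
    rw [mem_powerset] at hB
    rw [← mul_sum]
    gcongr
    rw [le_div_iff₀' hs]
    refine (hD.card_mul_sum_le i B (fun j hj => hLi j (hB hj)) _ (fun t => norm_nonneg _)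
      fun t v => ?_).trans ?_
    · congr 2
      funext ω
      refine prod_congr rfl fun j hj => ?_
      have := hLi j (mem_sdiff.1 hj).1
      rw [hD.update_of_ne i j this.1 this.2]
    · rw [← card_sdiff_of_subset hB]
      have hle : #(L \ B) ≤ #L := card_le_card sdiff_subset
      exact ih _ (by omega) (L \ B) rfl
  have hkap : ∀ r, ‖cumulantSucc μ r‖ ≤ τ * 2 ^ (r + 1) * r.factorial :=
    norm_cumulantSucc_le μ τ hτ0 hτ1 hμ
  -- Centring removes the block consisting of `i` alone, so every merger uses up at least two
  -- factors.
  have hkap0 : cumulantSucc μ 0 = 0 := by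
    rw [cumulantSucc.eq_def]
    simpa [hμdef] using hx
  have hterm : ∀ r ∈ range #L, ((#L).choose (r + 1) : ℝ) * (‖cumulantSucc μ (r + 1)‖ * N *
      (s ^ Fintype.card κ * a ^ (#L - (r + 1)) / s)) ≤
      s ^ Fintype.card κ * ((τ * N / s) * 2 ^ (r + 2) * K ^ (r + 1) * a ^ (#L - (r + 1))) := by
    intro r _
    -- The number of blocks times the factorial from the cumulant bound is a descending factorial.
    have hc : ((#L).choose (r + 1) : ℝ) * (r + 1).factorial ≤ K ^ (r + 1) := by
      have h1 : (#L).choose (r + 1) * (r + 1).factorial ≤ #L ^ (r + 1) := by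
        rw [mul_comm, ← Nat.descFactorial_eq_factorial_mul_choose]
        exact Nat.descFactorial_le_pow _ _
      have h2 : (#L : ℝ) ≤ K := Nat.cast_le.2 (card_le_univ L)
      calc ((#L).choose (r + 1) : ℝ) * (r + 1).factorial ≤ (#L : ℝ) ^ (r + 1) := by
            exact_mod_cast h1
        _ ≤ K ^ (r + 1) := by gcongr
    calc _ ≤ ((#L).choose (r + 1) : ℝ) * ((τ * 2 ^ (r + 1 + 1) * (r + 1).factorial) * N *
          (s ^ Fintype.card κ * a ^ (#L - (r + 1)) / s)) := by
            gcongr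
            exact hkap _
      _ = (s ^ Fintype.card κ * ((τ * N / s) * 2 ^ (r + 2) * a ^ (#L - (r + 1)))) *
          (((#L).choose (r + 1) : ℝ) * (r + 1).factorial) := by ring
      _ ≤ (s ^ Fintype.card κ * ((τ * N / s) * 2 ^ (r + 2) * a ^ (#L - (r + 1)))) *
          K ^ (r + 1) := by gcongr
      _ = _ := by ring
  calc _ ≤ ∑ t, ∑ B ∈ L.powerset, ‖cumulantSucc μ #B‖ * N *
        (if D i t + ∑ j ∈ B, D j t = 0 then
          ‖prodExpect p fun ω => ∏ j ∈ L \ B, noise e x ω (D j t)‖ else 0) :=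
        sum_le_sum fun t _ => hrec t
    _ ≤ ∑ B ∈ L.powerset, ‖cumulantSucc μ #B‖ * N *
        (s ^ Fintype.card κ * a ^ (#L - #B) / s) := by
        rw [sum_comm]
        exact sum_le_sum hmain
    _ = ∑ r ∈ range (#L + 1), ((#L).choose r : ℝ) * (‖cumulantSucc μ r‖ * N *
        (s ^ Fintype.card κ * a ^ (#L - r) / s)) := by
        rw [sum_powerset_apply_card (fun r => ‖cumulantSucc μ r‖ * N *
          (s ^ Fintype.card κ * a ^ (#L - r) / s))]
        simp only [nsmul_eq_mul]
    _ = ∑ r ∈ range #L, ((#L).choose (r + 1) : ℝ) * (‖cumulantSucc μ (r + 1)‖ * N *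
        (s ^ Fintype.card κ * a ^ (#L - (r + 1)) / s)) := by
        rw [sum_range_succ']
        simp [hkap0]
    _ ≤ ∑ r ∈ range #L, s ^ Fintype.card κ *
        ((τ * N / s) * 2 ^ (r + 2) * K ^ (r + 1) * a ^ (#L - (r + 1))) := sum_le_sum hterm
    _ ≤ s ^ Fintype.card κ * a ^ n := by
        rw [← mul_sum, ← hcard]
        gcongr
        exact sum_geometric_bound _ K a hK' ha ha2 _

/-! ### Chains and moments of the iterated kernel. -/

/-- The iterates of `u ↦ (t ↦ ∑ t' ∈ T, Y (t - t') * u t')` started at `z`. -/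
def chainSum {G : Type*} [AddCommGroup G] (Y : G → ℂ) (T : Finset G) (z : G → ℂ) :
    ℕ → G → ℂ
  | 0 => z
  | m + 1 => fun t => ∑ t' ∈ T, Y (t - t') * chainSum Y T z m t'

/-- The vertices of a chain which starts at `t` and goes on with `y`. -/
def chainPoint {G : Type*} {T : Finset G} {m : ℕ} (t : G) (y : Fin m → T) : Fin (m + 1) → G :=
  Fin.cons t fun j => (y j : G)

theorem chainPoint_cons_succ {G : Type*} {T : Finset G} {m : ℕ} (t : G) (t' : T) (y : Fin m → T)
    (i : Fin (m + 1)) :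
    chainPoint t (Fin.cons t' y : Fin (m + 1) → T) i.succ = chainPoint (t' : G) y i := by
  unfold chainPoint
  rw [Fin.cons_succ]
  refine Fin.cases ?_ (fun j => ?_) i <;> simp

theorem chainSum_eq_sum {G : Type*} [AddCommGroup G] (Y : G → ℂ) (T : Finset G) (z : G → ℂ)
    (m : ℕ) (t : G) :
    chainSum Y T z m t = ∑ y : Fin m → T,
      (∏ j, Y (chainPoint t y j.castSucc - y j)) * z (chainPoint t y (Fin.last m)) := by
  induction m generalizing t with
  | zero => simp [chainSum, chainPoint]
  | succ m ih =>
    rw [← (Fin.consEquiv fun _ : Fin (m + 1) => (T : Type _)).sum_comp, Fintype.sum_prod_type]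
    simp only [chainSum]
    rw [← sum_coe_sort T]
    refine sum_congr rfl fun t' _ => ?_
    rw [ih, mul_sum]
    refine sum_congr rfl fun y _ => ?_
    have hlast : Fin.last (m + 1) = (Fin.last m).succ := rfl
    have hcons : (Fin.consEquiv fun _ : Fin (m + 1) => (T : Type _)) (t', y) =
        (Fin.cons t' y : Fin (m + 1) → T) := rfl
    have hzero : ∀ y : Fin (m + 1) → T, chainPoint t y 0 = t := fun _ => rfl
    rw [hcons, hlast, Fin.prod_univ_succ, Fin.castSucc_zero]
    simp only [← Fin.succ_castSucc, chainPoint_cons_succ, Fin.cons_succ, Fin.cons_zero, hzero,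
      mul_assoc]

theorem chainPoint_castSucc_congr {G : Type*} {T : Finset G} {m : ℕ} (t : G) (y y' : Fin m → T)
    (j : Fin m) (h : ∀ i < j, y i = y' i) :
    chainPoint t y j.castSucc = chainPoint t y' j.castSucc := by
  cases m with
  | zero => exact j.elim0
  | succ m =>
    induction j using Fin.cases with
    | zero => simp [chainPoint]
    | succ j =>
      rw [← Fin.succ_castSucc]
      simp only [chainPoint, Fin.cons_succ]
      rw [h _ (Fin.castSucc_lt_succ)]

/-- The differences along a family of chains with the common origin `t₀`; the sign of the chains
with second index `true` is reversed. -/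
def chainDiff {G : Type*} [AddCommGroup G] {T : Finset G} {m q : ℕ} (t₀ : G)
    (k : (Fin q × Bool) × Fin m) (t : (Fin q × Bool) × Fin m → T) : G :=
  let d := chainPoint t₀ (fun j => t (k.1, j)) k.2.castSucc - t k
  if k.1.2 then -d else d

/-- The rank is the position in the chain. A difference involves only its own vertex, injectively,
and the preceding vertex of the same chain. -/
theorem isTriangular_chainDiff {G : Type*} [AddCommGroup G] {T : Finset G} {m q : ℕ} (t₀ : G) :
    IsTriangular (fun k : (Fin q × Bool) × Fin m => (k.2 : ℕ))
      (chainDiff (T := T) (m := m) (q := q) t₀) := by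
  have key : ∀ i j : (Fin q × Bool) × Fin m, (j.2 : ℕ) ≤ i.2 →
      ∀ (t : (Fin q × Bool) × Fin m → T) v,
      chainPoint t₀ (fun l => Function.update t i v (j.1, l)) j.2.castSucc =
        chainPoint t₀ (fun l => t (j.1, l)) j.2.castSucc := by
    intro i j hij t v
    refine chainPoint_castSucc_congr _ _ _ _ fun l hl => ?_
    rw [Function.update_of_ne]
    rintro rfl
    exact absurd hij (not_le.2 hl)
  constructor
  · intro i j hne hij t v
    simp only [chainDiff, key i j hij t v, Function.update_of_ne hne]
  · intro j t v w hvw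
    simp only [chainDiff, key j j le_rfl, Function.update_self] at hvw
    split_ifs at hvw
    · exact Subtype.ext (sub_right_injective (neg_injective hvw))
    · exact Subtype.ext (sub_right_injective hvw)

theorem norm_prod_le_one {β : Type*} (s : Finset β) (f : β → ℂ) (h : ∀ b ∈ s, ‖f b‖ ≤ 1) :
    ‖∏ b ∈ s, f b‖ ≤ 1 := by
  rw [norm_prod]
  exact prod_le_one (fun _ _ => norm_nonneg _) h

/-- The even moments of the iterates of a random kernel. -/
theorem sum_prodWeight_mul_norm_chainSum_pow_le {ι G α : Type*} [Fintype ι] [DecidableEq ι]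
    [Fintype α] [AddCommGroup G] [Finite G] [DecidableEq G] (e : ι → AddChar G ℂ) (N : ℝ)
    (hN : 0 ≤ N) (he : ∀ d, ∑ k, e k d = if d = 0 then (N : ℂ) else 0)
    (p x : α → ℝ) (hp : ∑ v, p v = 1) (hx : ∑ v, p v * x v = 0) (τ : ℝ) (hτ0 : 0 ≤ τ)
    (hτ1 : τ ≤ 1) (hμ : ∀ n, |∑ v, p v * x v ^ (n + 1)| ≤ τ) (T : Finset G) (hT : T.Nonempty)
    (z : G → ℂ) (hz : ∀ t, ‖z t‖ ≤ 1) (q m : ℕ) (hq : 0 < q) (hm : 0 < m) (a : ℝ)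
    (ha : 4 * (2 * q * m) ≤ a) (ha2 : 8 * (τ * N / #T) * (2 * q * m) ≤ a ^ 2) (t₀ : G) :
    ∑ ω : ι → α, prodWeight p ω *
        ‖chainSum (noise e (fun v => (x v : ℂ)) ω) T z m t₀‖ ^ (2 * q) ≤
      (#T * a) ^ (2 * q * m) := by
  set Y : (ι → α) → G → ℂ := fun ω => noise e (fun v => (x v : ℂ)) ω with hY
  have hconj : ∀ ω d, (starRingEnd ℂ) (Y ω d) = Y ω (-d) := by
    intro ω d
    simp only [hY, noise, map_sum, map_mul, Complex.conj_ofReal, AddChar.map_neg_eq_conj]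
  -- The even power is a product of `q` copies of the iterate and `q` conjugates; conjugating `Y`
  -- reverses the sign of its argument.
  let zz : Fin q × Bool → G → ℂ := fun i t => if i.2 then (starRingEnd ℂ) (z t) else z t
  have hzz : ∀ i t, ‖zz i t‖ ≤ 1 := by
    intro i t
    simp only [zz]
    split_ifs
    · rw [RCLike.norm_conj]; exact hz t
    · exact hz t
  have hfactor : ∀ ω (i : Fin q × Bool),
      (if i.2 then (starRingEnd ℂ) (chainSum (Y ω) T z m t₀) else chainSum (Y ω) T z m t₀) =
        ∑ y : Fin m → T, (∏ j, Y ω (if i.2 then -(chainPoint t₀ y j.castSucc - y j) else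
          (chainPoint t₀ y j.castSucc - y j))) * zz i (chainPoint t₀ y (Fin.last m)) := by
    rintro ω ⟨i, b⟩
    cases b
    · simp [chainSum_eq_sum, zz]
    · simp only [chainSum_eq_sum, zz, map_sum, map_mul, map_prod, hconj, if_true]
  have hpow : ∀ ω, ((‖chainSum (Y ω) T z m t₀‖ ^ (2 * q) : ℝ) : ℂ) =
      ∏ i : Fin q × Bool, (if i.2 then (starRingEnd ℂ) (chainSum (Y ω) T z m t₀) else
        chainSum (Y ω) T z m t₀) := by
    intro ω
    rw [Fintype.prod_prod_type]
    simp only [Fintype.prod_bool, if_true, Bool.false_eq_true, if_false, prod_const, card_univ,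
      Fintype.card_fin]
    rw [Complex.conj_mul', pow_mul]
    push_cast
    rfl
  let c : ((Fin q × Bool) × Fin m → T) → ℂ := fun t =>
    ∏ i : Fin q × Bool, zz i (chainPoint t₀ (fun j => t (i, j)) (Fin.last m))
  have hexpand : ∀ ω, ((‖chainSum (Y ω) T z m t₀‖ ^ (2 * q) : ℝ) : ℂ) =
      ∑ t : (Fin q × Bool) × Fin m → T, c t * ∏ k, Y ω (chainDiff t₀ k t) := by
    intro ω
    rw [hpow]
    simp only [hfactor]
    rw [prod_univ_sum, Fintype.piFinset_univ,
      ← (Equiv.curry (Fin q × Bool) (Fin m) (T : Type _)).sum_comp]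
    refine sum_congr rfl fun t _ => ?_
    rw [prod_mul_distrib, mul_comm, Fintype.prod_prod_type (f := fun k => Y ω (chainDiff t₀ k t))]
    rfl
  have hcard : Fintype.card ((Fin q × Bool) × Fin m) = 2 * q * m := by
    simp [mul_comm]
  have hne : Nonempty T := hT.to_subtype
  have hpC : ∑ v, (p v : ℂ) = 1 := by exact_mod_cast hp
  have hxC : ∑ v, (p v : ℂ) * (x v : ℂ) = 0 := by exact_mod_cast hx
  have hμC : ∀ n, ‖∑ v, (p v : ℂ) * (x v : ℂ) ^ (n + 1)‖ ≤ τ := by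
    intro n
    have := hμ n
    rw [← Real.norm_eq_abs, ← Complex.norm_real] at this
    simpa using this
  have hbound := sum_norm_prodExpect_prod_noise_le e N hN he (fun v => (p v : ℂ))
    (fun v => (x v : ℂ)) hpC hxC τ hτ0 hτ1 hμC
    (isTriangular_chainDiff (T := T) (m := m) (q := q) t₀) a (by rw [hcard]; positivity)
    (by rw [hcard]; push_cast; exact ha)
    (by rw [hcard, Fintype.card_coe]; push_cast; exact ha2) univ
  rw [card_univ, hcard, Fintype.card_coe, ← mul_pow] at hbound
  refine le_trans ?_ hbound
  have hE : ((∑ ω : ι → α, prodWeight p ω * ‖chainSum (Y ω) T z m t₀‖ ^ (2 * q) : ℝ) : ℂ) =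
      ∑ t : (Fin q × Bool) × Fin m → T, c t * prodExpect (fun v => (p v : ℂ))
        (fun ω => ∏ k, Y ω (chainDiff t₀ k t)) := by
    simp_rw [← prodExpect_const_mul]
    rw [← prodExpect_sum]
    unfold prodExpect
    rw [Complex.ofReal_sum]
    refine sum_congr rfl fun ω _ => ?_
    rw [Complex.ofReal_mul, hexpand]
    simp [prodWeight]
  refine (le_abs_self _).trans ?_
  rw [← Real.norm_eq_abs, ← Complex.norm_real, hE]
  refine (norm_sum_le _ _).trans (sum_le_sum fun t _ => ?_)
  rw [norm_mul]
  -- The end factors have modulus at most one, so only absolute values of mixed moments remain.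
  exact mul_le_of_le_one_left (norm_nonneg _) (norm_prod_le_one _ _ fun i _ => hzz i _)

/-! ### Tail bounds for Bernoulli selectors. -/

/-- The weights of a Bernoulli variable with parameter `τ`. -/
def bernoulliWeight (τ : ℝ) (b : Bool) : ℝ := if b then τ else 1 - τ

/-- A centred Bernoulli variable. -/
def centredBernoulli (τ : ℝ) (b : Bool) : ℝ := (if b then 1 else 0) - τ

theorem prodWeight_bernoulliWeight_nonneg {ι : Type*} [Fintype ι] {τ : ℝ} (hτ0 : 0 ≤ τ)
    (hτ1 : τ ≤ 1) (ω : ι → Bool) : 0 ≤ prodWeight (bernoulliWeight τ) ω := by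
  refine prod_nonneg fun k _ => ?_
  unfold bernoulliWeight
  split_ifs <;> linarith

theorem sum_bernoulliWeight (τ : ℝ) : ∑ b, bernoulliWeight τ b = 1 := by
  simp [bernoulliWeight]

theorem sum_bernoulliWeight_mul_centredBernoulli (τ : ℝ) :
    ∑ b, bernoulliWeight τ b * centredBernoulli τ b = 0 := by
  simp [bernoulliWeight, centredBernoulli]
  ring

/-- The first moment is zero; from the second on, the bound is `τ * (1 - τ) + (1 - τ) * τ ^ 2 = τ -
τ ^ 3`. -/
theorem abs_moment_centredBernoulli_le {τ : ℝ} (hτ0 : 0 ≤ τ) (hτ1 : τ ≤ 1) (n : ℕ) :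
    |∑ b, bernoulliWeight τ b * centredBernoulli τ b ^ (n + 1)| ≤ τ := by
  simp only [Fintype.sum_bool, bernoulliWeight, centredBernoulli, if_true, Bool.false_eq_true,
    if_false, zero_sub]
  rcases n with _ | n
  · rw [show τ * (1 - τ) ^ (0 + 1) + (1 - τ) * (-τ) ^ (0 + 1) = 0 by ring]
    simpa using hτ0
  have h1 : |(1 - τ) ^ (n + 1 + 1)| ≤ 1 - τ := by
    rw [abs_of_nonneg (pow_nonneg (by linarith) _)]
    exact pow_le_of_le_one (by linarith) (by linarith) (by omega)
  have h2 : |(-τ) ^ (n + 1 + 1)| ≤ τ ^ 2 := by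
    rw [abs_pow, abs_neg, abs_of_nonneg hτ0]
    exact pow_le_pow_of_le_one hτ0 hτ1 (by omega)
  calc _ ≤ |τ * (1 - τ) ^ (n + 1 + 1)| + |(1 - τ) * (-τ) ^ (n + 1 + 1)| := abs_add_le _ _
    _ = τ * |(1 - τ) ^ (n + 1 + 1)| + (1 - τ) * |(-τ) ^ (n + 1 + 1)| := by
        rw [abs_mul, abs_mul, abs_of_nonneg hτ0, abs_of_nonneg (by linarith : 0 ≤ 1 - τ)]
    _ ≤ τ * (1 - τ) + (1 - τ) * τ ^ 2 := by
        have : 0 ≤ 1 - τ := by linarith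
        gcongr
    _ ≤ τ := by nlinarith [pow_nonneg hτ0 3, sq_nonneg τ]

/-- The tail bound for the iterates of the random kernel of a Bernoulli set of frequencies. -/
theorem sum_prodWeight_chainSum_gt_le {ι G : Type*} [Fintype ι] [DecidableEq ι]
    [AddCommGroup G] [Finite G] [DecidableEq G] (e : ι → AddChar G ℂ) (N : ℝ)
    (hN : 0 < N) (he : ∀ d, ∑ k, e k d = if d = 0 then (N : ℂ) else 0) (τ : ℝ) (hτ0 : 0 < τ)
    (hτ1 : τ ≤ 1) (T : Finset G) (z : G → ℂ) (hz : ∀ t, ‖z t‖ ≤ 1) (q m : ℕ) (hq : 0 < q)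
    (hm : 0 < m) (hqm : 384 * (2 * q * m) * #T ≤ τ * N) (t₀ : G) :
    ∑ ω : ι → Bool with (τ * N / 4) ^ m <
        ‖chainSum (noise e (fun v => (centredBernoulli τ v : ℂ)) ω) T z m t₀‖,
      prodWeight (bernoulliWeight τ) ω ≤ Real.exp (-(q * m)) := by
  set F : (ι → Bool) → ℝ := fun ω =>
    ‖chainSum (noise e (fun v => (centredBernoulli τ v : ℂ)) ω) T z m t₀‖ with hF
  have hR : 0 < τ * N / 4 := by positivity
  have hw := fun ω : ι → Bool => prodWeight_bernoulliWeight_nonneg hτ0.le hτ1 ω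
  rcases T.eq_empty_or_nonempty with rfl | hT
  · obtain ⟨j, rfl⟩ : ∃ j, m = j + 1 := ⟨m - 1, by omega⟩
    rw [sum_eq_zero]
    · positivity
    · intro ω hω
      simp only [mem_filter, chainSum, sum_empty, norm_zero] at hω
      exact absurd hω.2 (not_lt.2 (by positivity))
  have hs : (0 : ℝ) < #T := by exact_mod_cast hT.card_pos
  set lam : ℝ := τ * N / #T with hlam
  set K : ℝ := 2 * q * m with hK
  have hK0 : 0 < K := by positivity
  have hKlam : 384 * K ≤ lam := by
    rw [hlam, le_div_iff₀ hs]
    exact hqm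
  have hlam0 : 0 < lam := by linarith
  have ha2 : Real.sqrt (8 * lam * K) ^ 2 = 8 * lam * K := Real.sq_sqrt (by positivity)
  have hmom := sum_prodWeight_mul_norm_chainSum_pow_le e N hN.le he (bernoulliWeight τ)
    (centredBernoulli τ) (sum_bernoulliWeight τ)
    (sum_bernoulliWeight_mul_centredBernoulli τ) τ hτ0.le hτ1
    (abs_moment_centredBernoulli_le hτ0.le hτ1) T hT z hz q m hq hm (Real.sqrt (8 * lam * K))
    (Real.le_sqrt_of_sq_le (by nlinarith)) ha2.ge t₀
  have hmarkov : (τ * N / 4) ^ (2 * q * m) * ∑ ω with (τ * N / 4) ^ m < F ω,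
      prodWeight (bernoulliWeight τ) ω ≤ (#T * Real.sqrt (8 * lam * K)) ^ (2 * q * m) := by
    refine le_trans ?_ hmom
    rw [mul_sum]
    refine (sum_le_sum fun ω hω => ?_).trans
      (sum_le_sum_of_subset_of_nonneg (filter_subset _ univ) fun ω _ _ =>
        mul_nonneg (hw ω) (by positivity))
    rw [mul_comm]
    refine mul_le_mul_of_nonneg_left ?_ (hw ω)
    rw [mem_filter] at hω
    rw [show 2 * q * m = m * (2 * q) by ring, pow_mul]
    exact pow_le_pow_left₀ (by positivity) hω.2.le _
  -- Here `384 = 8 * 16 * 3`: the `8` comes from the moment parameter `a`, the `16` from the squared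
  -- threshold `1/4`, and the `3` pays for `Real.exp 1`.
  have hbase : (#T * Real.sqrt (8 * lam * K)) ^ 2 ≤ (τ * N / 4) ^ 2 * Real.exp (-1) := by
    have h1 : τ * N = lam * #T := by
      rw [hlam]
      field_simp
    have h3 : 1 / 3 ≤ Real.exp (-1) := by
      rw [Real.exp_neg, ← one_div]
      exact one_div_le_one_div_of_le (Real.exp_pos 1) (by linarith [Real.exp_one_lt_d9])
    rw [mul_pow, ha2, h1]
    calc (#T : ℝ) ^ 2 * (8 * lam * K) ≤ (lam * #T / 4) ^ 2 * (1 / 3) := by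
          have : 0 ≤ (#T : ℝ) ^ 2 * lam * (lam - 384 * K) :=
            mul_nonneg (mul_nonneg (sq_nonneg _) hlam0.le) (by linarith)
          nlinarith
      _ ≤ _ := mul_le_mul_of_nonneg_left h3 (sq_nonneg _)
  refine le_of_mul_le_mul_left (hmarkov.trans ?_) (pow_pos hR (2 * q * m))
  calc _ = ((#T * Real.sqrt (8 * lam * K)) ^ 2) ^ (q * m) := by rw [← pow_mul, mul_assoc 2 q m]
    _ ≤ ((τ * N / 4) ^ 2 * Real.exp (-1)) ^ (q * m) := by gcongr
    _ = _ := by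
        rw [mul_pow, ← pow_mul, ← mul_assoc, ← Real.exp_nat_mul]
        congr 2
        push_cast
        ring

/-! ### Inexact dual certificates. -/

theorem sum_range_neg_one_pow_telescope (v : ℕ → ℂ) (m : ℕ) :
    ∑ i ∈ range m, (-1) ^ i * (v i + v (i + 1)) = v 0 - (-1) ^ m * v m := by
  induction m with
  | zero => simp
  | succ m ih =>
    rw [sum_range_succ, ih]
    ring

/-- An inexact dual certificate for `z`, applied to a signal `h` whose Fourier coefficients vanish
on the sampled frequencies. -/
theorem norm_sum_mul_conj_le {ι G : Type*} [Fintype ι] [AddCommGroup G] [Fintype G]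
    [DecidableEq G] (e : ι → AddChar G ℂ) (N : ℝ) (hN : 0 < N)
    (he : ∀ d, ∑ k, e k d = if d = 0 then (N : ℂ) else 0) (τ : ℝ) (hτ0 : 0 < τ)
    (T : Finset G) (z : G → ℂ) (ω : ι → Bool) (m₀ : ℕ) (hm₀ : 0 < m₀)
    (hb : ∀ m, 0 < m → m ≤ m₀ → ∀ t,
      ‖chainSum (noise e (fun v => (centredBernoulli τ v : ℂ)) ω) T z m t‖ ≤ (τ * N / 4) ^ m)
    (h : G → ℂ) (hh : ∀ k, ω k = true → ∑ t, h t * e k (-t) = 0) :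
    ‖∑ t ∈ T, h t * (starRingEnd ℂ) (z t)‖ ≤
      (1 / 4) ^ m₀ * ∑ t ∈ T, ‖h t‖ + 1 / 3 * ∑ t ∈ Tᶜ, ‖h t‖ := by
  set Y : G → ℂ := noise e (fun v => (centredBernoulli τ v : ℂ)) ω with hY
  set c : ℂ := ((τ * N : ℝ) : ℂ)⁻¹ with hc
  have hτN : 0 < τ * N := by positivity
  let u : ℕ → G → ℂ := fun m t => c ^ m * chainSum Y T z m t
  have hu : ∀ m, 0 < m → m ≤ m₀ → ∀ t, ‖u m t‖ ≤ (1 / 4) ^ m := by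
    intro m hm hm0 t
    simp only [u, norm_mul, norm_pow, hc, norm_inv, Complex.norm_real,
      Real.norm_of_nonneg hτN.le]
    calc (τ * N)⁻¹ ^ m * ‖chainSum Y T z m t‖ ≤ (τ * N)⁻¹ ^ m * (τ * N / 4) ^ m := by
          gcongr
          exact hb m hm hm0 t
      _ = _ := by
          rw [← mul_pow]
          congr 1
          field_simp
  have hustep : ∀ m t, ∑ t' ∈ T, c * Y (t - t') * u m t' = u (m + 1) t := by
    intro m t
    simp only [u, chainSum, mul_sum]
    exact sum_congr rfl fun t' _ => by ring
  -- The normalised kernel of the sampled frequencies is the identity plus `c * Y`.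
  have hA : ∀ d, c * ∑ k with ω k = true, e k d = c * Y d + if d = 0 then 1 else 0 := by
    intro d
    have h1 : Y d = ∑ k with ω k = true, e k d - τ * ∑ k, e k d := by
      simp only [hY, noise, centredBernoulli, sum_filter, mul_sum]
      rw [← sum_sub_distrib]
      refine sum_congr rfl fun k _ => ?_
      cases ω k <;> simp [sub_mul]
    rw [h1, he]
    split_ifs
    · have : c * (τ * N) = 1 := by
        rw [hc]
        push_cast
        exact inv_mul_cancel₀ (by exact_mod_cast hτN.ne')
      linear_combination this
    · simp
  -- The truncated Neumann series, with the sampled kernel applied; it is thus a combination of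
  -- sampled characters. On `T` it telescopes, and off `T` only the terms `u (m + 1)` survive.
  let y : G → ℂ := fun t => ∑ m ∈ range m₀, (-1) ^ m *
    ∑ t' ∈ T, (c * ∑ k with ω k = true, e k (t - t')) * u m t'
  have hy : ∀ t, y t = ∑ m ∈ range m₀, (-1) ^ m * ((if t ∈ T then u m t else 0) + u (m + 1) t) := by
    intro t
    refine sum_congr rfl fun m _ => ?_
    congr 1
    simp only [hA, add_mul, sum_add_distrib, hustep, sub_eq_zero]
    rw [add_comm]
    simp
  have hyT : ∀ t ∈ T, ‖z t - y t‖ ≤ (1 / 4) ^ m₀ := by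
    intro t ht
    rw [hy]
    simp only [ht, if_true]
    rw [sum_range_neg_one_pow_telescope (fun m => u m t)]
    simpa [u, chainSum] using hu m₀ hm₀ le_rfl t
  have hyTc : ∀ t ∉ T, ‖y t‖ ≤ 1 / 3 := by
    intro t ht
    rw [hy]
    simp only [ht, if_false, zero_add]
    calc _ ≤ ∑ m ∈ range m₀, ‖(-1) ^ m * u (m + 1) t‖ := norm_sum_le _ _
      _ ≤ ∑ m ∈ range m₀, (1 / 4 : ℝ) ^ (m + 1) := by
          refine sum_le_sum fun m hm => ?_
          rw [mem_range] at hm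
          simpa using hu (m + 1) (by omega) (by omega) t
      _ = 1 / 3 * (1 - (1 / 4) ^ m₀) := by
          simp only [pow_succ, ← sum_mul]
          rw [geom_sum_eq (by norm_num)]
          ring
      _ ≤ 1 / 3 := by
          have : (0 : ℝ) ≤ (1 / 4) ^ m₀ := by positivity
          linarith
  have horth : ∑ t, h t * (starRingEnd ℂ) (y t) = 0 := by
    have h1 : ∀ t, h t * (starRingEnd ℂ) (y t) = ∑ m ∈ range m₀, ∑ t' ∈ T,
        ∑ k with ω k = true, ((-1) ^ m * (starRingEnd ℂ) (c * u m t') * e k t') *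
          (h t * e k (-t)) := by
      intro t
      simp only [y, map_sum, map_mul, map_pow, map_neg, map_one, mul_sum, sum_mul]
      refine sum_congr rfl fun m _ => sum_congr rfl fun t' _ => sum_congr rfl fun k _ => ?_
      rw [← AddChar.map_neg_eq_conj, neg_sub, sub_eq_add_neg, AddChar.map_add_eq_mul]
      ring
    simp only [h1]
    rw [sum_comm]
    refine sum_eq_zero fun m _ => ?_
    rw [sum_comm]
    refine sum_eq_zero fun t' _ => ?_
    rw [sum_comm]
    refine sum_eq_zero fun k hk => ?_
    rw [← mul_sum, hh k (mem_filter.1 hk).2, mul_zero]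
  have hsplit : ∑ t ∈ T, h t * (starRingEnd ℂ) (z t) =
      ∑ t ∈ T, h t * (starRingEnd ℂ) (z t - y t) - ∑ t ∈ Tᶜ, h t * (starRingEnd ℂ) (y t) := by
    rw [← sum_add_sum_compl T] at horth
    simp only [map_sub, mul_sub, sum_sub_distrib]
    linear_combination horth
  rw [hsplit]
  refine (norm_sub_le _ _).trans (add_le_add ?_ ?_)
  · rw [mul_sum]
    refine (norm_sum_le _ _).trans (sum_le_sum fun t ht => ?_)
    rw [norm_mul, RCLike.norm_conj, mul_comm]
    exact mul_le_mul_of_nonneg_right (hyT t ht) (norm_nonneg _)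
  · rw [mul_sum]
    refine (norm_sum_le _ _).trans (sum_le_sum fun t ht => ?_)
    rw [norm_mul, RCLike.norm_conj, mul_comm]
    exact mul_le_mul_of_nonneg_right (hyTc t (mem_compl.1 ht)) (norm_nonneg _)

/-- The sign `f t / |f t|` of a signal, equal to `0` where the signal vanishes. -/
noncomputable def signalSign {G : Type*} (f : G → ℂ) (t : G) : ℂ := f t / (‖f t‖ : ℂ)

theorem norm_signalSign_le {G : Type*} (f : G → ℂ) (t : G) : ‖signalSign f t‖ ≤ 1 := by
  rw [signalSign, norm_div, Complex.norm_real, norm_norm]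
  exact div_self_le_one _

theorem mul_conj_signalSign {G : Type*} (f : G → ℂ) (t : G) :
    f t * (starRingEnd ℂ) (signalSign f t) = ‖f t‖ := by
  rw [signalSign, map_div₀, Complex.conj_ofReal, mul_div_assoc', Complex.mul_conj']
  rcases eq_or_ne (f t) 0 with h | h
  · simp [h]
  · have : (‖f t‖ : ℂ) ≠ 0 := by simpa using h
    field_simp

/-- A perturbation on which the inexact dual certificates for the sign of `f` and for the unit
vectors of the support act strictly increases the `ℓ₁` norm. -/
theorem sum_norm_lt_sum_norm_add {G : Type*} [Fintype G] [DecidableEq G] (T : Finset G)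
    (f h : G → ℂ) (hf : ∀ t ∉ T, f t = 0) (hh : h ≠ 0) (ε : ℝ) (hε : #T * ε ≤ 1 / 4)
    (hε0 : 0 ≤ ε)
    (hsign : ‖∑ t ∈ T, h t * (starRingEnd ℂ) (signalSign f t)‖ ≤
      ε * ∑ t ∈ T, ‖h t‖ + 1 / 3 * ∑ t ∈ Tᶜ, ‖h t‖)
    (hunit : ∀ t ∈ T, ‖h t‖ ≤ ε * ∑ t ∈ T, ‖h t‖ + 1 / 3 * ∑ t ∈ Tᶜ, ‖h t‖) :
    ∑ t, ‖f t‖ < ∑ t, ‖f t + h t‖ := by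
  set a := ∑ t ∈ T, ‖h t‖ with ha
  set b := ∑ t ∈ Tᶜ, ‖h t‖ with hb
  have ha0 : 0 ≤ a := sum_nonneg fun _ _ => norm_nonneg _
  have hb0 : 0 ≤ b := sum_nonneg fun _ _ => norm_nonneg _
  have hsum : a ≤ #T * (ε * a + 1 / 3 * b) := by
    rw [← nsmul_eq_mul]
    exact sum_le_card_nsmul _ _ _ hunit
  -- From `a ≤ a / 4 + #T * b / 3`. Then `ε * a ≤ b / 9`, so the loss on `T` is at most `(1/9 + 1/3)
  -- * b`, less than the gain `b` off `T`.
  have ha1 : a ≤ 4 / 9 * (#T * b) := by nlinarith [mul_le_mul_of_nonneg_right hε ha0]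
  have hεa : ε * a ≤ 1 / 9 * b := by
    nlinarith [mul_le_mul_of_nonneg_left ha1 hε0, mul_le_mul_of_nonneg_right hε hb0]
  have hbpos : 0 < b := by
    refine lt_of_le_of_ne hb0 fun hb' => hh ?_
    have ha' : a = 0 := le_antisymm (by rw [← hb'] at ha1; simpa using ha1) ha0
    have hzT := (sum_eq_zero_iff_of_nonneg fun t (_ : t ∈ T) => norm_nonneg (h t)).1 ha'
    have hzTc := (sum_eq_zero_iff_of_nonneg fun t (_ : t ∈ Tᶜ) => norm_nonneg (h t)).1 hb'.symm
    funext t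
    by_cases ht : t ∈ T
    · exact norm_eq_zero.1 (hzT t ht)
    · exact norm_eq_zero.1 (hzTc t (mem_compl.2 ht))
  have hT : ∑ t ∈ T, ‖f t‖ - ‖∑ t ∈ T, h t * (starRingEnd ℂ) (signalSign f t)‖ ≤
      ∑ t ∈ T, ‖f t + h t‖ := by
    have h1 : ∑ t ∈ T, (f t + h t) * (starRingEnd ℂ) (signalSign f t) =
        ((∑ t ∈ T, ‖f t‖ : ℝ) : ℂ) + ∑ t ∈ T, h t * (starRingEnd ℂ) (signalSign f t) := by
      simp only [add_mul, sum_add_distrib, mul_conj_signalSign, Complex.ofReal_sum]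
    have h2 : ‖∑ t ∈ T, (f t + h t) * (starRingEnd ℂ) (signalSign f t)‖ ≤
        ∑ t ∈ T, ‖f t + h t‖ := by
      refine (norm_sum_le _ _).trans (sum_le_sum fun t _ => ?_)
      rw [norm_mul, RCLike.norm_conj]
      exact mul_le_of_le_one_right (norm_nonneg _) (norm_signalSign_le f t)
    rw [h1] at h2
    have h3 := norm_sub_le_norm_add ((∑ t ∈ T, ‖f t‖ : ℝ) : ℂ)
      (∑ t ∈ T, h t * (starRingEnd ℂ) (signalSign f t))
    rw [Complex.norm_real, Real.norm_of_nonneg (sum_nonneg fun _ _ => norm_nonneg _)] at h3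
    linarith
  have hTc : ∑ t ∈ Tᶜ, ‖f t + h t‖ = b :=
    sum_congr rfl fun t ht => by rw [hf t (mem_compl.1 ht), zero_add]
  have hfTc : ∑ t ∈ Tᶜ, ‖f t‖ = 0 :=
    sum_eq_zero fun t ht => by rw [hf t (mem_compl.1 ht), norm_zero]
  rw [← sum_add_sum_compl T, ← sum_add_sum_compl T (fun t => ‖f t + h t‖), hTc, hfTc]
  linarith

/-! ### The Fourier transform on the grid and the minimization problem. -/

/-- The character `t ↦ exp(2πi (k₁ t₁ + k₂ t₂) / n)` of the grid. -/
noncomputable def gridChar {n : ℕ} [NeZero n] (k : Grid n) : AddChar (Grid n) ℂ where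
  toFun t := ZMod.stdAddChar (k.1 * t.1 + k.2 * t.2)
  map_zero_eq_one' := by simp
  map_add_eq_mul' s t := by
    rw [← AddChar.map_add_eq_mul]
    congr 1
    simp only [Prod.fst_add, Prod.snd_add]
    ring

theorem gridChar_apply {n : ℕ} [NeZero n] (k t : Grid n) :
    gridChar k t = ZMod.stdAddChar (k.1 * t.1 + k.2 * t.2) := rfl

theorem sum_gridChar {n : ℕ} [NeZero n] (d : Grid n) :
    ∑ k, gridChar k d = if d = 0 then (((n : ℝ) ^ 2 : ℝ) : ℂ) else 0 := by
  simp only [gridChar_apply, AddChar.map_add_eq_mul, Fintype.sum_prod_type, ← mul_sum, ← sum_mul]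
  rw [AddChar.sum_mulShift _ (ZMod.isPrimitive_stdAddChar n),
    AddChar.sum_mulShift _ (ZMod.isPrimitive_stdAddChar n), ZMod.card]
  by_cases h1 : d.1 = 0 <;> by_cases h2 : d.2 = 0 <;> simp [h1, h2, Prod.ext_iff, sq]

theorem dft2_eq_sum_gridChar {n : ℕ} [NeZero n] (f : Grid n → ℂ) (k : Grid n) :
    dft2 f k = ∑ t, f t * gridChar k (-t) := by
  unfold dft2
  refine sum_congr rfl fun t _ => ?_
  rw [gridChar_apply]
  congr 2
  simp only [Prod.fst_neg, Prod.snd_neg]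
  ring

theorem minimizers_eq_singleton {n : ℕ} [NeZero n] (f : Grid n → ℂ) (W : Set (Grid n))
    (h : ∀ h : Grid n → ℂ, h ≠ 0 → (∀ k ∈ W, dft2 h k = 0) →
      l1Norm f < l1Norm fun t => f t + h t) : minimizers f W = {f} := by
  have key : ∀ g ∈ feasibleSet f W, g ≠ f → l1Norm f < l1Norm g := by
    intro g hg hne
    have := h (g - f) (sub_ne_zero.2 hne) fun k hk => by
      have hk' : dft2 g k = dft2 f k := hg k hk
      simp only [dft2, Pi.sub_apply, sub_mul, sum_sub_distrib] at hk' ⊢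
      rw [hk', sub_self]
    simpa using this
  have hf : f ∈ feasibleSet f W := fun _ _ => rfl
  ext g
  constructor
  · rintro ⟨hg, hmin⟩
    rw [isMinOn_iff] at hmin
    by_contra hne
    exact absurd (key g hg hne) (not_lt.2 (hmin f hf))
  · rintro rfl
    refine ⟨hf, fun g' hg' => ?_⟩
    by_cases hne : g' = g
    · rw [hne]
      exact le_refl (l1Norm g)
    · exact (key g' hg' hne).le

/-- The vectors for which a dual certificate is needed: the sign of `f` and the unit vectors of
the support. -/
noncomputable def certTarget {n : ℕ} [NeZero n] (f : Grid n → ℂ) (T : Finset (Grid n)) :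
    Option T → Grid n → ℂ
  | none => signalSign f
  | some t => Pi.single (t : Grid n) 1

theorem norm_certTarget_le {n : ℕ} [NeZero n] (f : Grid n → ℂ) (T : Finset (Grid n))
    (o : Option T) (t : Grid n) : ‖certTarget f T o t‖ ≤ 1 := by
  cases o with
  | none => exact norm_signalSign_le f t
  | some t' =>
    simp only [certTarget, Pi.single_apply]
    split_ifs <;> simp

/-- The failure of the decay of the iterates at one target, one step and one point. -/
def DecayFails {n : ℕ} [NeZero n] (τ : ℝ) (f : Grid n → ℂ) (T : Finset (Grid n))
    (ω : Grid n → Bool) (x : Option T × ℕ × Grid n) : Prop :=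
  (τ * (n : ℝ) ^ 2 / 4) ^ x.2.1 <
    ‖chainSum (noise gridChar (fun v => (centredBernoulli τ v : ℂ)) ω) T (certTarget f T x.1)
      x.2.1 x.2.2‖

/-- The condition `4 * n ^ 2 ≤ 4 ^ m₀` makes the certificate error, summed over `T`, at most `1/4`.
The unit vector targets read off the single values of `h`. -/
theorem minimizers_eq_singleton_of_decay {n : ℕ} [NeZero n] (τ : ℝ) (hτ0 : 0 < τ)
    (f : Grid n → ℂ) (T : Finset (Grid n)) (hf : ∀ t ∉ T, f t = 0) (ω : Grid n → Bool) (m₀ : ℕ)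
    (hm₀ : 0 < m₀) (hm₀' : 4 * (n : ℝ) ^ 2 ≤ 4 ^ m₀)
    (hgood : ∀ o m, 0 < m → m ≤ m₀ → ∀ t, ¬ DecayFails τ f T ω (o, m, t)) :
    minimizers f {k | ω k = true} = {f} := by
  have hn : (0 : ℝ) < (n : ℝ) ^ 2 := by
    have : (0 : ℝ) < n := by exact_mod_cast Nat.pos_of_ne_zero (NeZero.ne n)
    positivity
  refine minimizers_eq_singleton f _ fun h hne hh => ?_
  have hcert : ∀ o : Option T, ‖∑ t ∈ T, h t * (starRingEnd ℂ) (certTarget f T o t)‖ ≤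
      (1 / 4) ^ m₀ * ∑ t ∈ T, ‖h t‖ + 1 / 3 * ∑ t ∈ Tᶜ, ‖h t‖ := by
    intro o
    refine norm_sum_mul_conj_le gridChar ((n : ℝ) ^ 2) hn sum_gridChar τ hτ0 T (certTarget f T o) ω
      m₀ hm₀ (fun m hm hm' t => ?_) h fun k hk => ?_
    · have := hgood o m hm hm' t
      rwa [DecayFails, not_lt] at this
    rw [← dft2_eq_sum_gridChar]
    exact hh k hk
  have hT : (#T : ℝ) ≤ (n : ℝ) ^ 2 := by
    have := card_le_univ T
    rw [Fintype.card_prod, ZMod.card, ← sq] at this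
    exact_mod_cast this
  refine sum_norm_lt_sum_norm_add T f h hf hne ((1 / 4) ^ m₀) ?_ (by positivity) (hcert none)
    fun t ht => ?_
  · rw [one_div, inv_pow, ← div_eq_mul_inv, div_le_iff₀ (by positivity)]
    linarith
  · have := hcert (some ⟨t, ht⟩)
    simpa [certTarget, Pi.single_apply, apply_ite, ht] using this

/-! ### From random variables to product weights; union bound. -/

theorem measureReal_pattern_eq {ι S : Type*} [Fintype ι] [MeasurableSpace S] (P : Measure S)
    [IsProbabilityMeasure P] (τ : ℝ) (I : ι → S → ℝ) (hI : IsBernoulliFamily P τ I)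
    (ω : ι → Bool) :
    P.real {s | (fun k => decide (I k s = 1)) = ω} = prodWeight (bernoulliWeight τ) ω := by
  have hset : {s | (fun k => decide (I k s = 1)) = ω} =
      ⋂ k ∈ (univ : Finset ι), I k ⁻¹' (if ω k then {1} else {1}ᶜ) := by
    ext s
    simp only [Set.mem_ofPred_eq, funext_iff, Set.mem_iInter, mem_univ, forall_true_left,
      Set.mem_preimage]
    refine forall_congr' fun k => ?_
    cases ω k <;> simp
  rw [hset, measureReal_def, hI.indep.measure_inter_preimage_eq_mul _ fun k _ => ?_,
    ENNReal.toReal_prod]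
  · refine prod_congr rfl fun k _ => ?_
    have h1 : MeasurableSet (I k ⁻¹' {1}) := hI.measurable k (measurableSet_singleton 1)
    have h2 : P.real (I k ⁻¹' {1}) = τ := hI.prob_one k
    rw [← measureReal_def, bernoulliWeight]
    cases ω k
    · simp only [Bool.false_eq_true, if_false, Set.preimage_compl]
      rw [probReal_compl_eq_one_sub h1, h2]
    · simpa using h2
  · split_ifs
    · exact measurableSet_singleton 1
    · exact (measurableSet_singleton 1).compl

/-- Subadditivity over the bad patterns suffices, so `E` need not be measurable. -/
theorem one_sub_sum_le_measureReal {ι S : Type*} [Fintype ι] [DecidableEq ι] [MeasurableSpace S]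
    (P : Measure S) [IsProbabilityMeasure P] (τ : ℝ) (I : ι → S → ℝ)
    (hI : IsBernoulliFamily P τ I) (B : Finset (ι → Bool)) (E : Set S)
    (hE : ∀ s, (fun k => decide (I k s = 1)) ∉ B → s ∈ E) :
    1 - ∑ ω ∈ B, prodWeight (bernoulliWeight τ) ω ≤ P.real E := by
  have hcover : (Set.univ : Set S) ⊆
      E ∪ ⋃ ω ∈ B, {s | (fun k => decide (I k s = 1)) = ω} := by
    intro s _
    by_cases hs : (fun k => decide (I k s = 1)) ∈ B
    · right
      simp only [Set.mem_iUnion, Set.mem_ofPred_eq]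
      exact ⟨_, hs, rfl⟩
    · exact Or.inl (hE s hs)
  have h1 : (1 : ℝ) ≤ P.real (E ∪ ⋃ ω ∈ B, {s | (fun k => decide (I k s = 1)) = ω}) := by
    have h := measureReal_mono (μ := P) hcover
    rwa [probReal_univ] at h
  have h2 := measureReal_union_le (μ := P) E (⋃ ω ∈ B, {s | (fun k => decide (I k s = 1)) = ω})
  have h3 := measureReal_biUnion_finset_le (μ := P) B
    (fun ω => {s | (fun k => decide (I k s = 1)) = ω})
  simp only [measureReal_pattern_eq P τ I hI] at h3
  linarith

theorem sum_filter_exists_le {β γ : Type*} [Fintype β] (X : Finset γ) (Q : β → γ → Prop)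
    (w : β → ℝ) (hw : ∀ b, 0 ≤ w b) [∀ b c, Decidable (Q b c)]
    [DecidablePred fun b => ∃ c ∈ X, Q b c] :
    ∑ b with ∃ c ∈ X, Q b c, w b ≤ ∑ c ∈ X, ∑ b with Q b c, w b := by
  simp only [sum_filter]
  rw [sum_comm]
  refine sum_le_sum fun b _ => ?_
  have h0 : ∀ c ∈ X, 0 ≤ if Q b c then w b else 0 := fun c _ => by
    split_ifs
    · exact hw b
    · exact le_refl _
  split_ifs with h
  · obtain ⟨c, hc, hQ⟩ := h
    refine le_trans ?_ (single_le_sum h0 hc)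
    rw [if_pos hQ]
  · exact sum_nonneg h0

/-! ### Choice of parameters and conclusion. -/

/-- The choice of the moment used at step `m`. -/
theorem exists_moment_order {M N τ s : ℝ} (hM : 0 < M) (hN : 4 ≤ N)
    (hs : s ≤ 1 / (768 * (M + 6)) * (Real.log N)⁻¹ * (τ * N)) (hs0 : 0 ≤ s) (m : ℕ) (hm : 0 < m)
    (hmN : (m : ℝ) ≤ 3 * Real.log N) :
    ∃ q : ℕ, 0 < q ∧ 384 * (2 * q * m) * s ≤ τ * N ∧ Real.exp (-(q * m)) ≤ N ^ (-(M + 3)) := by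
  have hm' : (0 : ℝ) < m := by exact_mod_cast hm
  have hlog : 0 < Real.log N := Real.log_pos (by linarith)
  have hpos : 0 < (M + 3) * Real.log N / m := by positivity
  -- This is the least `q` with `q * m ≥ (M + 3) * log N`. Rounding up adds at most `m ≤ 3 * log N`,
  -- whence `M + 6`; and `768 = 2 * 384`.
  refine ⟨⌈(M + 3) * Real.log N / m⌉₊, Nat.ceil_pos.2 hpos, ?_, ?_⟩
  · have h1 := (Nat.ceil_lt_add_one hpos.le).le
    have h2 : (⌈(M + 3) * Real.log N / m⌉₊ : ℝ) * m ≤ (M + 6) * Real.log N := by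
      calc _ ≤ ((M + 3) * Real.log N / m + 1) * m := by gcongr
        _ = (M + 3) * Real.log N + m := by field_simp
        _ ≤ _ := by linarith
    calc _ = 768 * (⌈(M + 3) * Real.log N / m⌉₊ * m) * s := by ring
      _ ≤ 768 * ((M + 6) * Real.log N) * s := by gcongr
      _ ≤ 768 * ((M + 6) * Real.log N) *
          (1 / (768 * (M + 6)) * (Real.log N)⁻¹ * (τ * N)) := by gcongr
      _ = τ * N := by field_simp
  · rw [Real.rpow_def_of_pos (by linarith)]
    apply Real.exp_le_exp.2
    have h1 := Nat.le_ceil ((M + 3) * Real.log N / m)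
    rw [div_le_iff₀ hm'] at h1
    linarith

end ExactRecovery

theorem mainTheorem6 :
    ∀ M : ℝ, 0 < M → ∃ α : ℝ, 0 < α ∧ ∃ C : ℝ, 0 < C ∧
      ∀ (n : ℕ) [NeZero n], 2 ≤ n →
      ∀ τ : ℝ, 0 < τ → τ < 1 →
      ∀ (f : ExactRecovery.Grid n → ℂ) (T : Finset (ExactRecovery.Grid n)),
        Function.support f ⊆ (T : Set (ExactRecovery.Grid n)) →
        (T.card : ℝ) ≤ α * (Real.log ((n : ℝ) ^ 2))⁻¹ * (τ * (n : ℝ) ^ 2) →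
      ∀ {S : Type*} [MeasurableSpace S] (P : MeasureTheory.Measure S)
        [MeasureTheory.IsProbabilityMeasure P] (I : ExactRecovery.Grid n → S → ℝ),
        ExactRecovery.IsBernoulliFamily P τ I →
        1 - C * ((n : ℝ) ^ 2) ^ (-M) ≤
          P.real {s | ExactRecovery.minimizers f (ExactRecovery.frequencySet I s) = {f}} := by
  classical
  intro M hM
  -- There are `(#T + 1) * m₀ * N ≤ (2 * N) * (3 * N) * N = 6 * N ^ 3` possible failures, each of
  -- weight at most `N ^ (-(M + 3))`.
  refine ⟨1 / (768 * (M + 6)), by positivity, 6, by norm_num, ?_⟩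
  intro n _ hn τ hτ0 hτ1 f T hfT hT S _ P _ I hI
  set N : ℝ := (n : ℝ) ^ 2 with hNdef
  have hN4 : 4 ≤ N := by
    have : (2 : ℝ) ≤ n := by exact_mod_cast hn
    nlinarith
  have hlog1 : 1 ≤ Real.log N := by
    rw [Real.le_log_iff_exp_le (by linarith)]
    linarith [Real.exp_one_lt_d9]
  have hlogN : Real.log N ≤ N := (Real.log_le_sub_one_of_pos (by linarith)).trans (by linarith)
  -- Since `Real.exp 1 ≤ 4`, the ceiling gives `N ≤ 4 ^ ⌈log N⌉₊`; the extra step supplies the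
  -- factor `4`.
  set m₀ : ℕ := ⌈Real.log N⌉₊ + 1 with hm₀
  have hm₀log : (m₀ : ℝ) ≤ 3 * Real.log N := by
    have := Nat.ceil_lt_add_one (by linarith : 0 ≤ Real.log N)
    rw [hm₀]
    push_cast
    linarith
  have hm₀pow : 4 * N ≤ 4 ^ m₀ := by
    rw [hm₀, pow_succ, mul_comm]
    gcongr
    calc N = Real.exp (Real.log N) := (Real.exp_log (by linarith)).symm
      _ ≤ Real.exp (⌈Real.log N⌉₊ : ℝ) := Real.exp_le_exp.2 (Nat.le_ceil _)
      _ = Real.exp 1 ^ ⌈Real.log N⌉₊ := by rw [← Real.exp_nat_mul, mul_one]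
      _ ≤ 4 ^ ⌈Real.log N⌉₊ := by
          gcongr
          linarith [Real.exp_one_lt_d9]
  have hcardG : Fintype.card (ExactRecovery.Grid n) = n ^ 2 := by
    rw [Fintype.card_prod, ZMod.card, sq]
  have hTN : (T.card : ℝ) ≤ N := by
    have := Finset.card_le_univ T
    rw [hcardG] at this
    rw [hNdef]
    exact_mod_cast this
  let X : Finset (Option T × ℕ × ExactRecovery.Grid n) :=
    Finset.univ ×ˢ Finset.Icc 1 m₀ ×ˢ Finset.univ
  let B : Finset (ExactRecovery.Grid n → Bool) :=
    Finset.univ.filter fun ω => ∃ c ∈ X, ExactRecovery.DecayFails τ f T ω c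
  have hB : ∑ ω ∈ B, ExactRecovery.prodWeight (ExactRecovery.bernoulliWeight τ) ω ≤
      6 * N ^ (-M) := by
    refine (ExactRecovery.sum_filter_exists_le X _ _ fun ω =>
      ExactRecovery.prodWeight_bernoulliWeight_nonneg hτ0.le hτ1.le ω).trans ?_
    have hterm : ∀ c ∈ X, ∑ ω with ExactRecovery.DecayFails τ f T ω c,
        ExactRecovery.prodWeight (ExactRecovery.bernoulliWeight τ) ω ≤ N ^ (-(M + 3)) := by
      rintro ⟨o, m, t⟩ hc
      simp only [X, Finset.mem_product, Finset.mem_univ, true_and, and_true,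
        Finset.mem_Icc] at hc
      have hmlog : (m : ℝ) ≤ 3 * Real.log N := le_trans (by exact_mod_cast hc.2) hm₀log
      obtain ⟨q, hq, hqm, hexp⟩ := ExactRecovery.exists_moment_order hM hN4 hT
        (Nat.cast_nonneg _) m hc.1 hmlog
      have htail := ExactRecovery.sum_prodWeight_chainSum_gt_le ExactRecovery.gridChar N
        (by linarith) ExactRecovery.sum_gridChar τ hτ0 hτ1.le T (ExactRecovery.certTarget f T o)
        (ExactRecovery.norm_certTarget_le f T o) q m hq hc.1 hqm t
      refine le_trans (le_of_eq (Finset.sum_congr ?_ fun _ _ => rfl)) (htail.trans hexp)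
      ext ω
      rw [Finset.mem_filter, Finset.mem_filter]
      rfl
    refine (Finset.sum_le_card_nsmul X _ _ hterm).trans ?_
    have hX : (X.card : ℝ) = (T.card + 1) * (m₀ * N) := by
      simp only [X, Finset.card_product, Finset.card_univ, Fintype.card_option,
        Fintype.card_coe, Nat.card_Icc, hcardG, Nat.add_sub_cancel]
      push_cast
      rw [hNdef]
    rw [nsmul_eq_mul, hX]
    have hsplit : N ^ (-M) = N ^ 3 * N ^ (-(M + 3)) := by
      rw [← Real.rpow_natCast, ← Real.rpow_add (by linarith)]
      congr 1
      push_cast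
      ring
    rw [hsplit, ← mul_assoc 6]
    refine mul_le_mul_of_nonneg_right ?_ (by positivity)
    calc ((T.card : ℝ) + 1) * (m₀ * N) ≤ (2 * N) * ((3 * N) * N) := by
          gcongr <;> linarith
      _ = 6 * N ^ 3 := by ring
  refine le_trans (by linarith) (ExactRecovery.one_sub_sum_le_measureReal P τ I hI B _ ?_)
  intro s hs
  have hgood : ∀ o m, 0 < m → m ≤ m₀ → ∀ t,
      ¬ ExactRecovery.DecayFails τ f T (fun k => decide (I k s = 1)) (o, m, t) := by
    intro o m hm hm' t hbad
    refine hs (Finset.mem_filter.2 ⟨Finset.mem_univ _, (o, m, t), ?_, hbad⟩)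
    simp only [X, Finset.mem_product, Finset.mem_univ, true_and, and_true, Finset.mem_Icc]
    exact ⟨hm, hm'⟩
  have := ExactRecovery.minimizers_eq_singleton_of_decay τ hτ0 f T
    (fun t ht => by
      by_contra h
      exact ht (Finset.mem_coe.1 (hfT h))) _ m₀ (Nat.succ_pos _) hm₀pow hgood
  simpa [ExactRecovery.frequencySet] using this
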